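/- Let $\mathbb{F}$ be an algebraically closed field of characteristic different from $2$. Let $\mathcal{C}$ be the split octonion algebra over $\mathbb{F}$ (the Cayley--Dickson double, with parameter $1$, of $M_2(\mathbb{F})$), with norm $n$, polar form $n(a,b)=n(a+b)-n(a)-n(b)$ and standard involution $a\mapsto\bar a$. Let $\mathbb{A}=\mathcal{H}_3(\mathcal{C})$ be the split Albert algebra of hermitian $3\times 3$ matrices over $\mathcal{C}$ with the product $\frac12(xy+yx)$ (matrix products on the right). Let $E_1,E_2,E_3$ be its diagonal matrix units, and for $a\in\mathcal{C}$ let $\iota_1(a),\iota_2(a),\iota_3(a)\in\mathbb{A}$ be the hermitian matrices whose entries in positions $(3,2)$, $(1,3)$, $(2,1)$, respectively, are $2a$, whose entries in the transposed positions are $2\bar a$, and whose other entries are $0$. From now on products are taken in $\mathbb{A}$. For $x=\sum_{i=1}^3(\alpha_iE_i+\iota_i(a_i))$ put $$T(x)=\alpha_1+\alpha_2+\alpha_3,\qquad S(x)=\tfrac12\bigl(T(x)^2-T(x^2)\bigr),\qquad N(x)=\alpha_1\alpha_2\alpha_3+8\,n(a_1,\bar a_2\bar a_3)-4\sum_{i=1}^3\alpha_i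 n(a_i),$$ $x^\#=x^2-T(x)x+S(x)1$ and $U_x(y)=2x(xy)-x^2y$. Let $\mathrm{rank}(x)$ be the dimension of the image of the linear map $U_x\colon\mathbb{A}\to\mathbb{A}$. An isometry of $\mathbb{A}$ is a linear bijection $\varphi\colon\mathbb{A}\to\mathbb{A}$ with $N(\varphi(x))=N(x)$ for all $x\in\mathbb{A}$. Then: 1. If $x,y\in\mathbb{A}$ have rank $1$, then $N(x+y)=0$. 2. If $x_1,x_2,x_3\in\mathbb{A}$ have rank $1$ and $N(x_1+x_2+x_3)\neq 0$, then $x_i+x_j$ has rank $10$ for all $i\neq j$. 3. If $x_1,x_2,x_3\in\mathbb{A}$ have rank $1$ and $N(x_1+x_2+x_3)=1$, then there is an isometry of $\mathbb{A}$ sending $x_i$ to $E_i$ for $i=1,2,3$. 4. If $\mathrm{rank}(x)=1$, then $\mathrm{rank}(x^\#)=0$; if $\mathrm{rank}(x)=10$, then $\mathrm{rank}(x^\#)=1$; if $\mathrm{rank}(x)=27$, then $\mathrm{rank}(x^\#)=27$. For every $x\in\mathbb{A}$, $\mathrm{rank}(x^\#)\leq\mathrm{rank}(x)$. -/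

import Mathlib

set_option linter.unusedSimpArgs false
set_option linter.unusedSectionVars false
set_option linter.unnecessarySeqFocus false

/-- The split octonion algebra over `F`: the Cayley--Dickson double, with parameter `1`, of the split
quaternion algebra of `2 × 2` matrices. The pair `⟨p, q⟩` stands for `p + u q`, where `u² = 1`. -/
@[ext]
structure SplitOctonion (F : Type*) where
  fst : Matrix (Fin 2) (Fin 2) F
  snd : Matrix (Fin 2) (Fin 2) F

namespace SplitOctonion

variable {F : Type*} [Field F]

instance : Zero (SplitOctonion F) := ⟨⟨0, 0⟩⟩
instance : Add (SplitOctonion F) := ⟨fun x y => ⟨x.fst + y.fst, x.snd + y.snd⟩⟩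
instance : Neg (SplitOctonion F) := ⟨fun x => ⟨-x.fst, -x.snd⟩⟩
instance : Sub (SplitOctonion F) := ⟨fun x y => ⟨x.fst - y.fst, x.snd - y.snd⟩⟩
instance {R : Type*} [SMul R F] : SMul R (SplitOctonion F) := ⟨fun c x => ⟨c • x.fst, c • x.snd⟩⟩
instance : One (SplitOctonion F) := ⟨⟨1, 0⟩⟩

/-- The product `(p₁ + u q₁)(p₂ + u q₂) = (p₁ p₂ + q₂ q̄₁) + u (p̄₁ q₂ + p₂ q₁)`, where the standard
involution `p ↦ p̄` of the algebra of `2 × 2` matrices is the adjugate. -/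
instance : Mul (SplitOctonion F) :=
  ⟨fun x y => ⟨x.fst * y.fst + y.snd * x.snd.adjugate, x.fst.adjugate * y.snd + y.fst * x.snd⟩⟩

@[simp] theorem fst_zero : (0 : SplitOctonion F).fst = 0 := rfl
@[simp] theorem snd_zero : (0 : SplitOctonion F).snd = 0 := rfl
@[simp] theorem fst_one : (1 : SplitOctonion F).fst = 1 := rfl
@[simp] theorem snd_one : (1 : SplitOctonion F).snd = 0 := rfl
@[simp] theorem fst_add (x y : SplitOctonion F) : (x + y).fst = x.fst + y.fst := rfl
@[simp] theorem snd_add (x y : SplitOctonion F) : (x + y).snd = x.snd + y.snd := rfl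
@[simp] theorem fst_neg (x : SplitOctonion F) : (-x).fst = -x.fst := rfl
@[simp] theorem snd_neg (x : SplitOctonion F) : (-x).snd = -x.snd := rfl
@[simp] theorem fst_sub (x y : SplitOctonion F) : (x - y).fst = x.fst - y.fst := rfl
@[simp] theorem snd_sub (x y : SplitOctonion F) : (x - y).snd = x.snd - y.snd := rfl
@[simp] theorem fst_smul {R : Type*} [SMul R F] (c : R) (x : SplitOctonion F) :
    (c • x).fst = c • x.fst := rfl
@[simp] theorem snd_smul {R : Type*} [SMul R F] (c : R) (x : SplitOctonion F) :
    (c • x).snd = c • x.snd := rfl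
@[simp] theorem fst_mul (x y : SplitOctonion F) :
    (x * y).fst = x.fst * y.fst + y.snd * x.snd.adjugate := rfl
@[simp] theorem snd_mul (x y : SplitOctonion F) :
    (x * y).snd = x.fst.adjugate * y.snd + y.fst * x.snd := rfl

theorem toProd_injective :
    Function.Injective (fun x : SplitOctonion F => (x.fst, x.snd)) := by
  intro x y h
  exact SplitOctonion.ext (congrArg Prod.fst h) (congrArg Prod.snd h)

instance : AddCommGroup (SplitOctonion F) :=
  toProd_injective.addCommGroup _ rfl (fun _ _ => rfl) (fun _ => rfl) (fun _ _ => rfl)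
    (fun _ _ => rfl) (fun _ _ => rfl)

instance : Module F (SplitOctonion F) :=
  toProd_injective.module F
    { toFun := fun x : SplitOctonion F => (x.fst, x.snd), map_zero' := rfl,
      map_add' := fun _ _ => rfl }
    (fun _ _ => rfl)

/-- The standard involution `p + u q ↦ p̄ - u q`. -/
def conj (x : SplitOctonion F) : SplitOctonion F := ⟨x.fst.adjugate, -x.snd⟩

/-- The norm `n`, so that `x * conj x = n(x) 1`. -/
def norm (x : SplitOctonion F) : F := x.fst.det - x.snd.det

/-- The polar form `n(x, y) = n(x + y) - n(x) - n(y)` of the norm. -/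
def normPolar (x y : SplitOctonion F) : F := norm (x + y) - norm x - norm y

theorem mul_conj_self (x : SplitOctonion F) : x * conj x = norm x • (1 : SplitOctonion F) := by
  ext i j
  · simp [conj, norm, Matrix.mul_adjugate]
    ring
  · simp [conj]

theorem adjugate_apply (p : Matrix (Fin 2) (Fin 2) F) :
    p.adjugate 0 0 = p 1 1 ∧ p.adjugate 0 1 = -p 0 1 ∧ p.adjugate 1 0 = -p 1 0 ∧
      p.adjugate 1 1 = p 0 0 := by
  simp [Matrix.adjugate_fin_two]

theorem ext_entries {x y : SplitOctonion F} (h00 : x.fst 0 0 = y.fst 0 0)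
    (h01 : x.fst 0 1 = y.fst 0 1) (h10 : x.fst 1 0 = y.fst 1 0) (h11 : x.fst 1 1 = y.fst 1 1)
    (k00 : x.snd 0 0 = y.snd 0 0) (k01 : x.snd 0 1 = y.snd 0 1) (k10 : x.snd 1 0 = y.snd 1 0)
    (k11 : x.snd 1 1 = y.snd 1 1) : x = y := by
  ext i j <;> fin_cases i <;> fin_cases j <;> assumption

theorem conj_add (x y : SplitOctonion F) :
    conj (x + y) = conj x + conj y := by
  apply ext_entries <;>
    simp only [conj, norm, normPolar, fst_mul, snd_mul, fst_add, snd_add, fst_smul, snd_smul,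
      fst_one, snd_one, Matrix.add_apply, Matrix.smul_apply, Matrix.neg_apply, Matrix.mul_apply,
      Fin.sum_univ_two, adjugate_apply, smul_eq_mul, Matrix.det_fin_two, Matrix.one_apply_eq,
      Matrix.one_fin_two, Matrix.zero_apply, Matrix.of_apply, Matrix.cons_val', Matrix.cons_val] <;>
    ring

theorem conj_smul (c : F) (x : SplitOctonion F) :
    conj (c • x) = c • conj x := by
  apply ext_entries <;>
    simp only [conj, norm, normPolar, fst_mul, snd_mul, fst_add, snd_add, fst_smul, snd_smul,
      fst_one, snd_one, Matrix.add_apply, Matrix.smul_apply, Matrix.neg_apply, Matrix.mul_apply,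
      Fin.sum_univ_two, adjugate_apply, smul_eq_mul, Matrix.det_fin_two, Matrix.one_apply_eq,
      Matrix.one_fin_two, Matrix.zero_apply, Matrix.of_apply, Matrix.cons_val', Matrix.cons_val] <;>
    ring

theorem conj_conj (x : SplitOctonion F) :
    conj (conj x) = x := by
  apply ext_entries <;>
    simp only [conj, norm, normPolar, fst_mul, snd_mul, fst_add, snd_add, fst_smul, snd_smul,
      fst_one, snd_one, Matrix.add_apply, Matrix.smul_apply, Matrix.neg_apply, Matrix.mul_apply,
      Fin.sum_univ_two, adjugate_apply, smul_eq_mul, Matrix.det_fin_two, Matrix.one_apply_eq,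
      Matrix.one_fin_two, Matrix.zero_apply, Matrix.of_apply, Matrix.cons_val', Matrix.cons_val] <;>
    ring

theorem conj_one :
    conj (1 : SplitOctonion F) = 1 := by
  apply ext_entries <;>
    simp only [conj, norm, normPolar, fst_mul, snd_mul, fst_add, snd_add, fst_smul, snd_smul,
      fst_one, snd_one, Matrix.add_apply, Matrix.smul_apply, Matrix.neg_apply, Matrix.mul_apply,
      Fin.sum_univ_two, adjugate_apply, smul_eq_mul, Matrix.det_fin_two, Matrix.one_apply_eq,
      Matrix.one_fin_two, Matrix.zero_apply, Matrix.of_apply, Matrix.cons_val', Matrix.cons_val] <;>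
    ring

theorem conj_mul (x y : SplitOctonion F) :
    conj (x * y) = conj y * conj x := by
  apply ext_entries <;>
    simp only [conj, norm, normPolar, fst_mul, snd_mul, fst_add, snd_add, fst_smul, snd_smul,
      fst_one, snd_one, Matrix.add_apply, Matrix.smul_apply, Matrix.neg_apply, Matrix.mul_apply,
      Fin.sum_univ_two, adjugate_apply, smul_eq_mul, Matrix.det_fin_two, Matrix.one_apply_eq,
      Matrix.one_fin_two, Matrix.zero_apply, Matrix.of_apply, Matrix.cons_val', Matrix.cons_val] <;>
    ring

theorem add_mul' (x y z : SplitOctonion F) :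
    (x + y) * z = x * z + y * z := by
  apply ext_entries <;>
    simp only [conj, norm, normPolar, fst_mul, snd_mul, fst_add, snd_add, fst_smul, snd_smul,
      fst_one, snd_one, Matrix.add_apply, Matrix.smul_apply, Matrix.neg_apply, Matrix.mul_apply,
      Fin.sum_univ_two, adjugate_apply, smul_eq_mul, Matrix.det_fin_two, Matrix.one_apply_eq,
      Matrix.one_fin_two, Matrix.zero_apply, Matrix.of_apply, Matrix.cons_val', Matrix.cons_val] <;>
    ring

theorem mul_add' (x y z : SplitOctonion F) :
    x * (y + z) = x * y + x * z := by
  apply ext_entries <;>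
    simp only [conj, norm, normPolar, fst_mul, snd_mul, fst_add, snd_add, fst_smul, snd_smul,
      fst_one, snd_one, Matrix.add_apply, Matrix.smul_apply, Matrix.neg_apply, Matrix.mul_apply,
      Fin.sum_univ_two, adjugate_apply, smul_eq_mul, Matrix.det_fin_two, Matrix.one_apply_eq,
      Matrix.one_fin_two, Matrix.zero_apply, Matrix.of_apply, Matrix.cons_val', Matrix.cons_val] <;>
    ring

theorem smul_mul' (c : F) (x y : SplitOctonion F) :
    (c • x) * y = c • (x * y) := by
  apply ext_entries <;>
    simp only [conj, norm, normPolar, fst_mul, snd_mul, fst_add, snd_add, fst_smul, snd_smul,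
      fst_one, snd_one, Matrix.add_apply, Matrix.smul_apply, Matrix.neg_apply, Matrix.mul_apply,
      Fin.sum_univ_two, adjugate_apply, smul_eq_mul, Matrix.det_fin_two, Matrix.one_apply_eq,
      Matrix.one_fin_two, Matrix.zero_apply, Matrix.of_apply, Matrix.cons_val', Matrix.cons_val] <;>
    ring

theorem mul_smul' (c : F) (x y : SplitOctonion F) :
    x * (c • y) = c • (x * y) := by
  apply ext_entries <;>
    simp only [conj, norm, normPolar, fst_mul, snd_mul, fst_add, snd_add, fst_smul, snd_smul,
      fst_one, snd_one, Matrix.add_apply, Matrix.smul_apply, Matrix.neg_apply, Matrix.mul_apply,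
      Fin.sum_univ_two, adjugate_apply, smul_eq_mul, Matrix.det_fin_two, Matrix.one_apply_eq,
      Matrix.one_fin_two, Matrix.zero_apply, Matrix.of_apply, Matrix.cons_val', Matrix.cons_val] <;>
    ring

theorem one_mul' (x : SplitOctonion F) :
    1 * x = x := by
  apply ext_entries <;>
    simp only [conj, norm, normPolar, fst_mul, snd_mul, fst_add, snd_add, fst_smul, snd_smul,
      fst_one, snd_one, Matrix.add_apply, Matrix.smul_apply, Matrix.neg_apply, Matrix.mul_apply,
      Fin.sum_univ_two, adjugate_apply, smul_eq_mul, Matrix.det_fin_two, Matrix.one_apply_eq,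
      Matrix.one_fin_two, Matrix.zero_apply, Matrix.of_apply, Matrix.cons_val', Matrix.cons_val] <;>
    ring

theorem mul_one' (x : SplitOctonion F) :
    x * 1 = x := by
  apply ext_entries <;>
    simp only [conj, norm, normPolar, fst_mul, snd_mul, fst_add, snd_add, fst_smul, snd_smul,
      fst_one, snd_one, Matrix.add_apply, Matrix.smul_apply, Matrix.neg_apply, Matrix.mul_apply,
      Fin.sum_univ_two, adjugate_apply, smul_eq_mul, Matrix.det_fin_two, Matrix.one_apply_eq,
      Matrix.one_fin_two, Matrix.zero_apply, Matrix.of_apply, Matrix.cons_val', Matrix.cons_val] <;>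
    ring

theorem mul_conj_add (x y : SplitOctonion F) :
    x * conj y + y * conj x = normPolar x y • (1 : SplitOctonion F) := by
  apply ext_entries <;>
    simp only [conj, norm, normPolar, fst_mul, snd_mul, fst_add, snd_add, fst_smul, snd_smul,
      fst_one, snd_one, Matrix.add_apply, Matrix.smul_apply, Matrix.neg_apply, Matrix.mul_apply,
      Fin.sum_univ_two, adjugate_apply, smul_eq_mul, Matrix.det_fin_two, Matrix.one_apply_eq,
      Matrix.one_fin_two, Matrix.zero_apply, Matrix.of_apply, Matrix.cons_val', Matrix.cons_val] <;>
    ring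

theorem conj_mul_add (x y : SplitOctonion F) :
    conj x * y + conj y * x = normPolar x y • (1 : SplitOctonion F) := by
  apply ext_entries <;>
    simp only [conj, norm, normPolar, fst_mul, snd_mul, fst_add, snd_add, fst_smul, snd_smul,
      fst_one, snd_one, Matrix.add_apply, Matrix.smul_apply, Matrix.neg_apply, Matrix.mul_apply,
      Fin.sum_univ_two, adjugate_apply, smul_eq_mul, Matrix.det_fin_two, Matrix.one_apply_eq,
      Matrix.one_fin_two, Matrix.zero_apply, Matrix.of_apply, Matrix.cons_val', Matrix.cons_val] <;>
    ring

theorem normPolar_add (x y z : SplitOctonion F) :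
    normPolar x (y + z) = normPolar x y + normPolar x z := by
  simp [normPolar, norm, Matrix.det_fin_two]; ring

theorem normPolar_smul (c : F) (x y : SplitOctonion F) :
    normPolar x (c • y) = c * normPolar x y := by
  simp [normPolar, norm, Matrix.det_fin_two]; ring

end SplitOctonion

/-- The split Albert algebra `H₃(C) = F E₁ ⊕ F E₂ ⊕ F E₃ ⊕ ι₁(C) ⊕ ι₂(C) ⊕ ι₃(C)`, where `C` is the
split octonion algebra: `⟨α, a⟩` stands for `∑ i, (α i • E i + ι i (a i))`, with indices modulo `3`.
See `Albert.toMatrix` for the corresponding hermitian matrix. -/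
@[ext]
structure Albert (F : Type*) where
  diag : Fin 3 → F
  off : Fin 3 → SplitOctonion F

namespace Albert

variable {F : Type*} [Field F]

instance : Zero (Albert F) := ⟨⟨0, 0⟩⟩
instance : Add (Albert F) := ⟨fun x y => ⟨x.diag + y.diag, x.off + y.off⟩⟩
instance : Neg (Albert F) := ⟨fun x => ⟨-x.diag, -x.off⟩⟩
instance : Sub (Albert F) := ⟨fun x y => ⟨x.diag - y.diag, x.off - y.off⟩⟩
instance {R : Type*} [SMul R F] : SMul R (Albert F) := ⟨fun c x => ⟨c • x.diag, c • x.off⟩⟩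
/-- The unit element `E₁ + E₂ + E₃`. -/
instance : One (Albert F) := ⟨⟨1, 0⟩⟩

/-- The Jordan product: the commutative bilinear product in which the `E i` are orthogonal
idempotents and, with indices modulo `3`, `E i * ι i a = 0`,
`E (i+1) * ι i a = E (i+2) * ι i a = 1/2 • ι i a`, `ι i a * ι (i+1) b = ι (i+2) (conj a * conj b)`,
`ι i a * ι i b = 2 n(a, b) • (E (i+1) + E (i+2))`. It is the symmetrized matrix product, see
`Albert.toMatrix_mul`. -/
instance : Mul (Albert F) :=
  ⟨fun x y =>
    { diag := fun i => x.diag i * y.diag i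
        + 2 * SplitOctonion.normPolar (x.off (i + 1)) (y.off (i + 1))
        + 2 * SplitOctonion.normPolar (x.off (i + 2)) (y.off (i + 2))
      off := fun i => ((2 : F)⁻¹ * (x.diag (i + 1) + x.diag (i + 2))) • y.off i
        + ((2 : F)⁻¹ * (y.diag (i + 1) + y.diag (i + 2))) • x.off i
        + (x.off (i + 1)).conj * (y.off (i + 2)).conj
        + (y.off (i + 1)).conj * (x.off (i + 2)).conj }⟩

@[simp] theorem diag_zero : (0 : Albert F).diag = 0 := rfl
@[simp] theorem off_zero : (0 : Albert F).off = 0 := rfl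
@[simp] theorem diag_one : (1 : Albert F).diag = 1 := rfl
@[simp] theorem off_one : (1 : Albert F).off = 0 := rfl
@[simp] theorem diag_add (x y : Albert F) : (x + y).diag = x.diag + y.diag := rfl
@[simp] theorem off_add (x y : Albert F) : (x + y).off = x.off + y.off := rfl
@[simp] theorem diag_neg (x : Albert F) : (-x).diag = -x.diag := rfl
@[simp] theorem off_neg (x : Albert F) : (-x).off = -x.off := rfl
@[simp] theorem diag_sub (x y : Albert F) : (x - y).diag = x.diag - y.diag := rfl
@[simp] theorem off_sub (x y : Albert F) : (x - y).off = x.off - y.off := rfl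
@[simp] theorem diag_smul {R : Type*} [SMul R F] (c : R) (x : Albert F) :
    (c • x).diag = c • x.diag := rfl
@[simp] theorem off_smul {R : Type*} [SMul R F] (c : R) (x : Albert F) :
    (c • x).off = c • x.off := rfl

theorem diag_mul (x y : Albert F) (i : Fin 3) :
    (x * y).diag i = x.diag i * y.diag i
        + 2 * SplitOctonion.normPolar (x.off (i + 1)) (y.off (i + 1))
        + 2 * SplitOctonion.normPolar (x.off (i + 2)) (y.off (i + 2)) := rfl

theorem off_mul (x y : Albert F) (i : Fin 3) :
    (x * y).off i = ((2 : F)⁻¹ * (x.diag (i + 1) + x.diag (i + 2))) • y.off i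
        + ((2 : F)⁻¹ * (y.diag (i + 1) + y.diag (i + 2))) • x.off i
        + (x.off (i + 1)).conj * (y.off (i + 2)).conj
        + (y.off (i + 1)).conj * (x.off (i + 2)).conj := rfl

theorem toProd_injective :
    Function.Injective (fun x : Albert F => (x.diag, x.off)) := by
  intro x y h
  exact Albert.ext (congrArg Prod.fst h) (congrArg Prod.snd h)

instance : AddCommGroup (Albert F) :=
  toProd_injective.addCommGroup _ rfl (fun _ _ => rfl) (fun _ => rfl) (fun _ _ => rfl)
    (fun _ _ => rfl) (fun _ _ => rfl)

instance : Module F (Albert F) :=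
  toProd_injective.module F
    { toFun := fun x : Albert F => (x.diag, x.off), map_zero' := rfl,
      map_add' := fun _ _ => rfl }
    (fun _ _ => rfl)

/-- The diagonal idempotents: `E 0`, `E 1`, `E 2` are `E₁`, `E₂`, `E₃`. -/
def E (i : Fin 3) : Albert F := ⟨Pi.single i 1, 0⟩

/-- The hermitian octonion matrix corresponding to an element of the Albert algebra. -/
def toMatrix (x : Albert F) : Matrix (Fin 3) (Fin 3) (SplitOctonion F) :=
  !![x.diag 0 • 1, (2 : F) • (x.off 2).conj, (2 : F) • x.off 1;
     (2 : F) • x.off 2, x.diag 1 • 1, (2 : F) • (x.off 0).conj;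
     (2 : F) • (x.off 1).conj, (2 : F) • x.off 0, x.diag 2 • 1]

/-- The Jordan product is the symmetrized matrix product `(1/2)(XY + YX)`. -/
theorem toMatrix_mul (h2 : (2 : F) ≠ 0) (x y : Albert F) :
    toMatrix (x * y) = (2 : F)⁻¹ • (toMatrix x * toMatrix y + toMatrix y * toMatrix x) := by
  have d1 := fun i => SplitOctonion.mul_conj_add (x.off i) (y.off i)
  have d2 := fun i => SplitOctonion.conj_mul_add (x.off i) (y.off i)
  ext1 i j
  fin_cases i <;> fin_cases j <;>
    simp only [toMatrix, Matrix.mul_apply, Fin.sum_univ_three, diag_mul, off_mul, Matrix.of_apply,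
      Matrix.add_apply, Matrix.smul_apply, Matrix.cons_val', Matrix.cons_val, Fin.zero_eta,
      Fin.mk_one, Fin.reduceFinMk, Fin.isValue, Fin.reduceAdd, zero_add,
      SplitOctonion.conj_add, SplitOctonion.conj_smul, SplitOctonion.conj_conj,
      SplitOctonion.conj_mul, SplitOctonion.smul_mul', SplitOctonion.mul_smul',
      SplitOctonion.one_mul', SplitOctonion.mul_one']
  · simp only [add_smul, mul_smul, ← d1 1, ← d2 2]
    match_scalars <;> field_simp <;> ring
  all_goals try (match_scalars <;> field_simp <;> ring; done)
  · simp only [add_smul, mul_smul, ← d1 2, ← d2 0]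
    match_scalars <;> field_simp <;> ring
  · simp only [add_smul, mul_smul, ← d1 0, ← d2 1]
    match_scalars <;> field_simp <;> ring

/-- In characteristic different from `2`, every hermitian octonion matrix arises from exactly one
element of the Albert algebra. -/
theorem existsUnique_toMatrix (h2 : (2 : F) ≠ 0) (X : Matrix (Fin 3) (Fin 3) (SplitOctonion F))
    (hX : ∀ i j, X j i = (X i j).conj) : ∃! x : Albert F, toMatrix x = X := by
  have hd : ∀ i, X i i = ((X i i).fst 0 0) • (1 : SplitOctonion F) := by
    intro i
    have h := hX i i
    have h1 : (X i i).snd = -(X i i).snd := congrArg SplitOctonion.snd h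
    have h3 : (X i i).fst = (X i i).fst.adjugate := congrArg SplitOctonion.fst h
    rw [Matrix.adjugate_fin_two] at h3
    have h01 := congrFun (congrFun h3 0) 1
    have h10 := congrFun (congrFun h3 1) 0
    have h11 := congrFun (congrFun h3 1) 1
    simp at h01 h10 h11
    ext k l
    · fin_cases k <;> fin_cases l <;> simp <;> grind
    · have h5 := congrFun (congrFun h1 k) l
      simp at h5 ⊢
      grind
  have hs : ∀ c : SplitOctonion F, (2 : F) • ((2 : F)⁻¹ • c) = c := fun c => by
    rw [smul_smul, mul_inv_cancel₀ h2, one_smul]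
  refine ⟨⟨fun i => (X i i).fst 0 0,
    ![(2 : F)⁻¹ • X 2 1, (2 : F)⁻¹ • X 0 2, (2 : F)⁻¹ • X 1 0]⟩, ?_, ?_⟩
  · ext1 i j
    fin_cases i <;> fin_cases j <;>
      simp only [toMatrix, Matrix.of_apply, Matrix.cons_val', Matrix.cons_val, Fin.zero_eta,
        Fin.mk_one, Fin.reduceFinMk, SplitOctonion.conj_smul, hs, ← hX, ← hd]
  · rintro ⟨d, o⟩ rfl
    have hs' : ∀ c : SplitOctonion F, (2 : F)⁻¹ • ((2 : F) • c) = c := fun c => by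
      rw [smul_smul, inv_mul_cancel₀ h2, one_smul]
    ext1
    · ext i; fin_cases i <;> simp [toMatrix]
    · ext1 i; fin_cases i <;> simp [toMatrix, hs']

theorem toMatrix_hermitian (x : Albert F) (i j : Fin 3) :
    toMatrix x j i = (toMatrix x i j).conj := by
  ext k l <;> fin_cases i <;> fin_cases j <;> fin_cases k <;> fin_cases l <;>
    simp [toMatrix, SplitOctonion.conj, Matrix.adjugate_fin_two]

/-- The generic trace. -/
def T (x : Albert F) : F := ∑ i, x.diag i

/-- The quadratic form `S` of the generic minimal polynomial. -/
def S (x : Albert F) : F := (2 : F)⁻¹ * (T x ^ 2 - T (x * x))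

/-- The generic norm. -/
def N (x : Albert F) : F :=
  x.diag 0 * x.diag 1 * x.diag 2
    + 8 * SplitOctonion.normPolar (x.off 0) ((x.off 1).conj * (x.off 2).conj)
    - 4 * ∑ i, x.diag i * (x.off i).norm

/-- The Freudenthal adjoint `x^# = x² - T(x) x + S(x) 1`. -/
def adj (x : Albert F) : Albert F := x * x - T x • x + S x • (1 : Albert F)

/-- The operator `y ↦ x y` of multiplication by `x`. -/
def L (x : Albert F) : Albert F →ₗ[F] Albert F where
  toFun y := x * y
  map_add' y z := by
    ext i
    · simp only [diag_mul, diag_add, off_add, Pi.add_apply, SplitOctonion.normPolar_add]; ring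
    all_goals
      simp only [off_mul, diag_add, off_add, Pi.add_apply, SplitOctonion.conj_add,
        SplitOctonion.mul_add', SplitOctonion.add_mul', smul_add, mul_add, add_smul]
      abel_nf
  map_smul' c y := by
    ext i
    · simp only [diag_mul, diag_smul, off_smul, Pi.smul_apply, SplitOctonion.normPolar_smul,
        smul_eq_mul, RingHom.id_apply]; ring
    all_goals
      simp only [off_mul, diag_smul, off_smul, Pi.smul_apply, SplitOctonion.conj_smul,
        SplitOctonion.mul_smul', SplitOctonion.smul_mul', smul_add, smul_smul, smul_eq_mul,
        RingHom.id_apply]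
      ring_nf

/-- The `U`-operator `U_x(y) = 2 x (x y) - x² y`. -/
def U (x : Albert F) : Albert F →ₗ[F] Albert F := (2 : F) • (L x ∘ₗ L x) - L (x * x)

theorem U_apply (x y : Albert F) : U x y = (2 : F) • (x * (x * y)) - (x * x) * y := rfl

/-- The rank of `x` is the dimension of the image of `U_x`. -/
noncomputable def rank (x : Albert F) : ℕ := Module.finrank F (LinearMap.range (U x))

/-- A norm isometry: a linear bijection that preserves the generic norm. -/
def IsIsometry (f : Albert F ≃ₗ[F] Albert F) : Prop := ∀ x, N (f x) = N x

end Albert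

/-!
The Albert algebra is treated as a cubic norm structure. With the bilinear trace form `T (x * y)`
and the linearization `cross x y` of the adjoint one has `U x y = T (x * y) • x - cross (adj x) y`
(`Albert.U_eq`) and `N (x + y) = N x + T (adj x * y) + T (x * adj y) + N y` (`Albert.N_add`).

Call `φ, ψ` an adjoint pair (`Albert.AdjointPair`) if they are bijective linear maps preserving
`N`, contragredient for the trace form, and exchanged by the adjoint: `adj (φ x) = ψ (adj x)` and
`adj (ψ x) = φ (adj x)`. The formula for `U` gives `U (φ x) ∘ ψ = φ ∘ U x`, so adjoint pairs
preserve the rank. Three explicit families suffice: the transvections `Albert.upper` and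
`Albert.lower`, which are the row-and-column operations `x ↦ g x g*` with `g` an elementary octonion
matrix, and the diagonal scalings `Albert.scale`.

Gaussian elimination with the transvections moves every element to a diagonal one
(`Albert.exists_off_eq_zero`). The place where elimination could get stuck, a block whose diagonal
vanishes, is handled by `SplitOctonion.eq_zero_of_quadratic_eq_zero`: as `w` runs over the
octonions, the new diagonal entry `α + 4 (n(w, a) + β n(w))` cannot vanish identically unless `α`,
`β` and `a` all vanish. For a diagonal element the operator `U` is diagonal in coordinates, and
counting its nonzero entries shows that the rank is `0`, `1`, `10` or `27` according to which of
`x`, `adj x` and `N x` vanish (`Albert.rank_cases`). All assertions about ranks follow from this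
table and from the expansion of `N (x + y)`.

For the transitivity on triples (`Albert.exists_isometry_map_eq_E`), elimination and a scaling,
which uses a square root, move the first element to `E 0`. The condition
`N (x 0 + x 1 + x 2) = 1` ensures that the second element can then be moved to `E 1` with `E 0`
fixed; finally the third one has last diagonal entry `1` and is cleared to `E 2` with `E 0` and
`E 1` fixed.
-/

/-! ### Octonion identities -/

namespace SplitOctonion
variable {F : Type*} [Field F]

theorem conj_neg (x : SplitOctonion F) : conj (-x) = - conj x := by
  rw [← neg_one_smul F x, conj_smul, neg_one_smul]

theorem neg_mul' (x y : SplitOctonion F) : -x * y = - (x * y) := by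
  rw [← neg_one_smul F x, SplitOctonion.smul_mul', neg_one_smul]

theorem mul_neg' (x y : SplitOctonion F) : x * -y = - (x * y) := by
  rw [← neg_one_smul F y, mul_smul', neg_one_smul]

theorem sub_mul' (x y z : SplitOctonion F) : (x - y) * z = x * z - y * z := by
  rw [sub_eq_add_neg, add_mul', neg_mul', sub_eq_add_neg]

theorem mul_sub' (x y z : SplitOctonion F) : x * (y - z) = x * y - x * z := by
  rw [sub_eq_add_neg, mul_add', mul_neg', sub_eq_add_neg]

theorem conj_sub (x y : SplitOctonion F) : conj (x - y) = conj x - conj y := by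
  rw [sub_eq_add_neg, conj_add, conj_neg, sub_eq_add_neg]

@[simp] theorem conj_zero : conj (0 : SplitOctonion F) = 0 := by
  rw [← zero_smul F (0 : SplitOctonion F), conj_smul, zero_smul, zero_smul]

@[simp] theorem zero_mul' (x : SplitOctonion F) : 0 * x = 0 := by
  rw [← zero_smul F (0 : SplitOctonion F), SplitOctonion.smul_mul', zero_smul, zero_smul]

@[simp] theorem mul_zero' (x : SplitOctonion F) : x * 0 = 0 := by
  rw [← zero_smul F (0 : SplitOctonion F), mul_smul', zero_smul, zero_smul]

theorem normPolar_eq (x y : SplitOctonion F) :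
    normPolar x y = x.fst 0 0 * y.fst 1 1 + x.fst 1 1 * y.fst 0 0 - x.fst 0 1 * y.fst 1 0
      - x.fst 1 0 * y.fst 0 1 - (x.snd 0 0 * y.snd 1 1 + x.snd 1 1 * y.snd 0 0
      - x.snd 0 1 * y.snd 1 0 - x.snd 1 0 * y.snd 0 1) := by
  simp only [normPolar, norm, Matrix.det_fin_two, fst_add, snd_add, Matrix.add_apply]
  ring

theorem normPolar_comm (x y : SplitOctonion F) : normPolar x y = normPolar y x := by
  rw [normPolar_eq, normPolar_eq]; ring

theorem add_normPolar (x y z : SplitOctonion F) :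
    normPolar (x + y) z = normPolar x z + normPolar y z := by
  rw [normPolar_comm, normPolar_add, normPolar_comm z, normPolar_comm z]

theorem smul_normPolar (c : F) (x y : SplitOctonion F) :
    normPolar (c • x) y = c * normPolar x y := by
  rw [normPolar_comm, normPolar_smul, normPolar_comm]

theorem neg_normPolar (x y : SplitOctonion F) : normPolar (-x) y = - normPolar x y := by
  rw [← neg_one_smul F x, smul_normPolar, neg_one_mul]

theorem normPolar_neg (x y : SplitOctonion F) : normPolar x (-y) = - normPolar x y := by
  rw [normPolar_comm, neg_normPolar, normPolar_comm]

theorem normPolar_sub (x y z : SplitOctonion F) :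
    normPolar x (y - z) = normPolar x y - normPolar x z := by
  rw [sub_eq_add_neg, normPolar_add, normPolar_neg, sub_eq_add_neg]

@[simp] theorem normPolar_zero (x : SplitOctonion F) : normPolar x 0 = 0 := by
  simp [normPolar_eq]

@[simp] theorem zero_normPolar (x : SplitOctonion F) : normPolar 0 x = 0 := by
  simp [normPolar_eq]

@[simp] theorem norm_zero' : (0 : SplitOctonion F).norm = 0 := by
  simp [norm]

theorem norm_smul' (c : F) (x : SplitOctonion F) : (c • x).norm = c ^ 2 * x.norm := by
  simp [norm, Matrix.det_fin_two]; ring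

theorem norm_neg' (x : SplitOctonion F) : (-x).norm = x.norm := by
  simp [norm, Matrix.det_fin_two]

theorem norm_conj (x : SplitOctonion F) : (conj x).norm = x.norm := by
  simp only [norm, conj, Matrix.det_fin_two, adjugate_apply, Matrix.neg_apply]; ring

theorem norm_add (x y : SplitOctonion F) : (x + y).norm = x.norm + y.norm + normPolar x y := by
  rw [normPolar]; ring

theorem norm_mul' (x y : SplitOctonion F) : (x * y).norm = x.norm * y.norm := by
  simp only [norm, Matrix.det_fin_two, fst_mul, snd_mul, Matrix.add_apply, Matrix.mul_apply,
    Fin.sum_univ_two, adjugate_apply]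
  ring

theorem normPolar_self (x : SplitOctonion F) : normPolar x x = 2 * x.norm := by
  rw [normPolar_eq, norm, Matrix.det_fin_two, Matrix.det_fin_two]; ring

theorem normPolar_conj_conj (x y : SplitOctonion F) :
    normPolar (conj x) (conj y) = normPolar x y := by
  simp only [normPolar, ← conj_add, norm_conj]

/-- The adjoint of left multiplication by `x` is left multiplication by `conj x`. -/
theorem normPolar_mul_left (x y z : SplitOctonion F) :
    normPolar (x * y) z = normPolar y (conj x * z) := by
  simp only [normPolar_eq, conj, fst_mul, snd_mul, Matrix.add_apply, Matrix.neg_apply,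
    Matrix.mul_apply, Fin.sum_univ_two, adjugate_apply]
  ring

/-- The adjoint of right multiplication by `y` is right multiplication by `conj y`. -/
theorem normPolar_mul_right (x y z : SplitOctonion F) :
    normPolar (x * y) z = normPolar x (z * conj y) := by
  rw [← normPolar_conj_conj, conj_mul, normPolar_mul_left, ← normPolar_conj_conj]
  simp only [conj_mul, conj_conj]

/-- The trilinear form `n(x, conj y * conj z)` is invariant under cyclic permutations. -/
theorem normPolar_cyclic (x y z : SplitOctonion F) :
    normPolar x (conj y * conj z) = normPolar y (conj z * conj x) := by
  rw [normPolar_comm, normPolar_mul_right, ← normPolar_conj_conj]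
  simp only [SplitOctonion.conj_mul, conj_conj]

/-- A form of the left alternative law. Together with its mirror image and their linearizations it
replaces associativity in the computations below. -/
theorem conj_mul_cancel (x y : SplitOctonion F) : conj x * (x * y) = x.norm • y := by
  apply ext_entries <;>
    simp only [conj, norm, fst_mul, snd_mul, fst_smul, snd_smul, Matrix.add_apply,
      Matrix.smul_apply, Matrix.neg_apply, Matrix.mul_apply, Fin.sum_univ_two, adjugate_apply,
      smul_eq_mul, Matrix.det_fin_two] <;>
    ring

theorem mul_mul_conj_cancel (x y : SplitOctonion F) : (x * y) * conj y = y.norm • x := by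
  have h := congrArg conj (conj_mul_cancel (conj y) (conj x))
  simpa only [conj_mul, conj_conj, conj_smul, norm_conj] using h

/-- The linearization of `conj_mul_cancel`. -/
theorem conj_mul_cancel_add (x y z : SplitOctonion F) :
    conj x * (y * z) + conj y * (x * z) = normPolar x y • z := by
  have h := conj_mul_cancel (x + y) z
  simp only [conj_add, add_mul', mul_add', conj_mul_cancel, norm_add, add_smul] at h
  rw [← sub_eq_zero] at h ⊢
  rw [← h]; abel

/-- The linearization of `mul_mul_conj_cancel`. -/
theorem mul_mul_conj_cancel_add (x y z : SplitOctonion F) :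
    (z * x) * conj y + (z * y) * conj x = normPolar x y • z := by
  have h := mul_mul_conj_cancel z (x + y)
  simp only [conj_add, add_mul', mul_add', mul_mul_conj_cancel, norm_add, add_smul] at h
  rw [← sub_eq_zero] at h ⊢
  rw [← h]; abel

end SplitOctonion

namespace Albert
open SplitOctonion
variable {F : Type*} [Field F]

/-! ### The adjoint, its linearization, and expansions of `U` and `N` -/

theorem adj_diag (h2 : (2 : F) ≠ 0) (x : Albert F) (i : Fin 3) :
    x.adj.diag i = x.diag (i + 1) * x.diag (i + 2) - 4 * (x.off i).norm := by
  simp only [adj, S, T, diag_add, diag_sub, diag_smul, diag_one, Pi.add_apply, Pi.sub_apply,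
    Pi.smul_apply, Pi.one_apply, smul_eq_mul, diag_mul, Fin.sum_univ_three]
  fin_cases i <;>
    simp [normPolar, SplitOctonion.norm, Matrix.det_fin_two] <;> field_simp <;> ring

theorem adj_off (h2 : (2 : F) ≠ 0) (x : Albert F) (i : Fin 3) :
    x.adj.off i = (2 : F) • ((x.off (i + 1)).conj * (x.off (i + 2)).conj)
      - x.diag i • x.off i := by
  have h : (2 : F)⁻¹ * 2 = 1 := inv_mul_cancel₀ h2
  simp only [adj, S, T, off_add, off_sub, off_smul, off_one, Pi.add_apply, Pi.sub_apply,
    Pi.smul_apply, Pi.zero_apply, smul_zero, add_zero, off_mul, Fin.sum_univ_three]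
  fin_cases i <;> simp <;> match_scalars <;> grind

theorem adj_zero : adj (0 : Albert F) = 0 := by
  simp [Albert.ext_iff, funext_iff, adj, S, T, diag_mul, off_mul]

theorem trace_mul (x y : Albert F) :
    T (x * y) = ∑ i, (x.diag i * y.diag i + 4 * normPolar (x.off i) (y.off i)) := by
  simp only [T, diag_mul, Fin.sum_univ_three]
  simp
  ring

/-- The linearization `x × y` of the adjoint, normalized so that `x × x = 2 adj x`. -/
def cross (x y : Albert F) : Albert F := adj (x + y) - adj x - adj y

theorem cross_diag (h2 : (2 : F) ≠ 0) (x y : Albert F) (i : Fin 3) :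
    (cross x y).diag i = x.diag (i + 1) * y.diag (i + 2) + x.diag (i + 2) * y.diag (i + 1)
      - 4 * normPolar (x.off i) (y.off i) := by
  simp only [cross, diag_sub, Pi.sub_apply, adj_diag h2, diag_add, off_add, Pi.add_apply, normPolar]
  ring

theorem cross_off (h2 : (2 : F) ≠ 0) (x y : Albert F) (i : Fin 3) :
    (cross x y).off i = (2 : F) • ((x.off (i + 1)).conj * (y.off (i + 2)).conj
      + (y.off (i + 1)).conj * (x.off (i + 2)).conj) - x.diag i • y.off i - y.diag i • x.off i := by
  simp only [cross, off_sub, Pi.sub_apply, adj_off h2, diag_add, off_add, Pi.add_apply, conj_add,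
    add_mul', mul_add']
  module

/-- Reduction of sums of indices modulo `3`. -/
theorem fin_three_add_add (i : Fin 3) :
    i + 1 + 1 = i + 2 ∧ i + 1 + 2 = i ∧ i + 2 + 1 = i ∧ i + 2 + 2 = i + 1 := by
  decide +revert

/-- The operator `U` expressed through the trace form and the adjoint. This is what makes `U`, and
hence the rank, equivariant under maps compatible with these two. -/
theorem U_eq (h2 : (2 : F) ≠ 0) (x y : Albert F) :
    U x y = T (x * y) • x - cross x.adj y := by
  have hT : ∀ i, T (x * y) = x.diag i * y.diag i + x.diag (i + 1) * y.diag (i + 1)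
      + x.diag (i + 2) * y.diag (i + 2) + 4 * (normPolar (x.off i) (y.off i)
      + normPolar (x.off (i + 1)) (y.off (i + 1)) + normPolar (x.off (i + 2)) (y.off (i + 2))) := by
    intro i
    rw [trace_mul, Fin.sum_univ_three]
    fin_cases i <;> simp <;> ring
  ext1
  · ext i
    rw [U_apply]
    simp only [diag_sub, diag_smul, Pi.sub_apply, Pi.smul_apply, diag_mul, off_mul, cross_diag h2,
      adj_diag h2, adj_off h2, hT i, smul_eq_mul, fin_three_add_add, normPolar_add, add_normPolar,
      normPolar_smul, smul_normPolar, normPolar_sub, normPolar_self, normPolar_comm (_ - _)]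
    generalize x.diag i = d0
    generalize x.diag (i + 1) = d1
    generalize x.diag (i + 2) = d2
    generalize y.diag i = e0
    generalize y.diag (i + 1) = e1
    generalize y.diag (i + 2) = e2
    generalize x.off i = a0
    generalize x.off (i + 1) = a1
    generalize x.off (i + 2) = a2
    generalize y.off i = b0
    generalize y.off (i + 1) = b1
    generalize y.off (i + 2) = b2
    have h1 := normPolar_cyclic a1 a2 b0
    have h3 := normPolar_cyclic a2 b0 a1
    have h4 := normPolar_cyclic b2 a0 a1
    have h5 := normPolar_cyclic a2 a0 b1
    have h6 := normPolar_cyclic a0 b1 a2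
    have h7 := normPolar_cyclic a0 a1 b2
    rw [normPolar_comm (_ * _), normPolar_comm (_ * _), normPolar_comm b0 a0]
    clear hT
    field_simp
    grind
  · ext1 i
    rw [U_apply]
    simp only [off_sub, off_smul, Pi.sub_apply, Pi.smul_apply, diag_mul, off_mul, cross_off h2,
      adj_diag h2, adj_off h2, hT i, fin_three_add_add, conj_add, conj_smul, conj_sub,
      SplitOctonion.conj_mul, conj_conj, mul_add', add_mul', SplitOctonion.smul_mul', mul_smul',
      sub_mul', mul_sub', conj_mul_cancel, mul_mul_conj_cancel, normPolar_self]
    generalize x.diag i = d0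
    generalize x.diag (i + 1) = d1
    generalize x.diag (i + 2) = d2
    generalize y.diag i = e0
    generalize y.diag (i + 1) = e1
    generalize y.diag (i + 2) = e2
    generalize x.off i = a0
    generalize x.off (i + 1) = a1
    generalize x.off (i + 2) = a2
    generalize y.off i = b0
    generalize y.off (i + 1) = b1
    generalize y.off (i + 2) = b2
    have h1 := conj_mul_cancel_add a1 b1 a0
    have h3 := mul_mul_conj_cancel_add b2 a2 a0
    rw [normPolar_comm b2] at h3
    linear_combination (norm := skip) (2 : F) • h1 + (2 : F) • h3
    match_scalars <;> field_simp <;> ring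

/-- The norm is cubic, with differential given by the adjoint and the trace form. -/
theorem N_add (h2 : (2 : F) ≠ 0) (x y : Albert F) :
    N (x + y) = N x + T (x.adj * y) + T (x * y.adj) + N y := by
  simp only [N, trace_mul, adj_diag h2, adj_off h2, Fin.sum_univ_three, diag_add, off_add,
    Pi.add_apply, Fin.isValue, Fin.reduceAdd, zero_add, conj_add, add_mul', mul_add',
    normPolar_add, add_normPolar, norm_add, normPolar_sub, normPolar_smul, normPolar_comm (_ - _),
    normPolar_cyclic (y.off 2) (x.off 0), normPolar_cyclic (x.off 2) (y.off 0),
    ← normPolar_cyclic (x.off 0) (y.off 1), ← normPolar_cyclic (y.off 0) (x.off 1)]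
  rw [normPolar_comm (y.off 0) (x.off 0), normPolar_comm (y.off 1) (x.off 1),
    normPolar_comm (y.off 2) (x.off 2)]
  ring

/-! ### Structural maps and the invariance of the rank -/

/-- A pair of norm isometries that is contragredient for the trace form `T (x * y)` and is exchanged
by the adjoint. -/
structure AdjointPair (φ ψ : Albert F ≃ₗ[F] Albert F) : Prop where
  isometry : IsIsometry φ
  isometry' : IsIsometry ψ
  adj_apply : ∀ x, adj (φ x) = ψ (adj x)
  adj_apply' : ∀ x, adj (ψ x) = φ (adj x)
  trace_mul : ∀ x y, T (φ x * ψ y) = T (x * y)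

theorem mul_comm' (x y : Albert F) : x * y = y * x := by
  ext1
  · ext i
    simp only [diag_mul, normPolar_eq]; ring
  · ext1 i
    simp only [off_mul]; abel

namespace AdjointPair

theorem refl : AdjointPair (LinearEquiv.refl F (Albert F)) (LinearEquiv.refl F (Albert F)) :=
  ⟨fun _ => rfl, fun _ => rfl, fun _ => rfl, fun _ => rfl, fun _ _ => rfl⟩

variable {φ ψ φ' ψ' : Albert F ≃ₗ[F] Albert F}

theorem symm (h : AdjointPair φ ψ) : AdjointPair ψ φ :=
  ⟨h.isometry', h.isometry, h.adj_apply', h.adj_apply, fun x y => by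
    rw [mul_comm', h.trace_mul, mul_comm']⟩

theorem trans (h : AdjointPair φ ψ) (h' : AdjointPair φ' ψ') :
    AdjointPair (φ.trans φ') (ψ.trans ψ') where
  isometry x := (h'.isometry _).trans (h.isometry x)
  isometry' x := (h'.isometry' _).trans (h.isometry' x)
  adj_apply x := (h'.adj_apply _).trans (congrArg ψ' (h.adj_apply x))
  adj_apply' x := (h'.adj_apply' _).trans (congrArg φ' (h.adj_apply' x))
  trace_mul x y := (h'.trace_mul _ _).trans (h.trace_mul x y)

theorem U_apply (h2 : (2 : F) ≠ 0) (h : AdjointPair φ ψ) (x y : Albert F) :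
    U (φ x) (ψ y) = φ (U x y) := by
  simp only [U_eq h2, h.trace_mul, cross, h.adj_apply, h.adj_apply', map_sub, map_smul, ← map_add]

theorem rank_apply (h2 : (2 : F) ≠ 0) (h : AdjointPair φ ψ) (x : Albert F) :
    rank (φ x) = rank x := by
  have h1 : U (φ x) ∘ₗ (ψ : Albert F →ₗ[F] Albert F) = (φ : Albert F →ₗ[F] Albert F) ∘ₗ U x :=
    LinearMap.ext fun y => h.U_apply h2 x y
  have h3 : LinearMap.range (U (φ x)) =
      (LinearMap.range (U x)).map (φ : Albert F →ₗ[F] Albert F) := by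
    rw [← LinearMap.range_comp, ← h1, LinearMap.range_comp, LinearEquiv.range, Submodule.map_top]
  rw [rank, rank, h3]
  exact LinearEquiv.finrank_map_eq φ _

end AdjointPair

/-- The transvection `x ↦ g x g*`, where `g = 1 + 2 conj w e` and `e` is the matrix unit in position
`(i + 1, i + 2)`: it adds a multiple of row and column `i + 2` to row and column `i + 1`. -/
def upper (i : Fin 3) (w : SplitOctonion F) : Albert F →ₗ[F] Albert F where
  toFun x :=
    { diag := fun j => x.diag j +
        if j = i + 1 then 4 * (normPolar w (x.off i) + x.diag (i + 2) * w.norm) else 0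
      off := fun j => x.off j +
        if j = i then x.diag (i + 2) • w
        else if j = i + 2 then (2 : F) • (w.conj * (x.off (i + 1)).conj) else 0 }
  map_add' x y := by
    ext1
    · ext j; simp only [diag_add, off_add, Pi.add_apply, normPolar_add]; split_ifs <;> ring
    · ext1 j; simp only [diag_add, off_add, Pi.add_apply, conj_add, mul_add']; split_ifs <;> module
  map_smul' c x := by
    ext1
    · ext j
      simp only [diag_smul, off_smul, Pi.smul_apply, normPolar_smul, smul_eq_mul, RingHom.id_apply]
      split_ifs <;> ring
    · ext1 j
      simp only [diag_smul, off_smul, Pi.smul_apply, conj_smul, mul_smul', smul_eq_mul,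
        RingHom.id_apply]
      split_ifs <;> module

/-- The transvection `x ↦ g x g*`, where `g = 1 + 2 w e` and `e` is the matrix unit in position
`(i + 2, i + 1)`: it adds a multiple of row and column `i + 1` to row and column `i + 2`. -/
def lower (i : Fin 3) (w : SplitOctonion F) : Albert F →ₗ[F] Albert F where
  toFun x :=
    { diag := fun j => x.diag j +
        if j = i + 2 then 4 * (normPolar w (x.off i) + x.diag (i + 1) * w.norm) else 0
      off := fun j => x.off j +
        if j = i then x.diag (i + 1) • w
        else if j = i + 1 then (2 : F) • ((x.off (i + 2)).conj * w.conj) else 0 }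
  map_add' x y := by
    ext1
    · ext j; simp only [diag_add, off_add, Pi.add_apply, normPolar_add]; split_ifs <;> ring
    · ext1 j; simp only [diag_add, off_add, Pi.add_apply, conj_add, add_mul']; split_ifs <;> module
  map_smul' c x := by
    ext1
    · ext j
      simp only [diag_smul, off_smul, Pi.smul_apply, normPolar_smul, smul_eq_mul, RingHom.id_apply]
      split_ifs <;> ring
    · ext1 j
      simp only [diag_smul, off_smul, Pi.smul_apply, conj_smul, SplitOctonion.smul_mul',
        smul_eq_mul, RingHom.id_apply]
      split_ifs <;> module

theorem upper_diag (i j : Fin 3) (w : SplitOctonion F) (x : Albert F) :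
    (upper i w x).diag j = x.diag j +
      if j = i + 1 then 4 * (normPolar w (x.off i) + x.diag (i + 2) * w.norm) else 0 := rfl

theorem upper_off (i j : Fin 3) (w : SplitOctonion F) (x : Albert F) :
    (upper i w x).off j = x.off j +
      if j = i then x.diag (i + 2) • w
      else if j = i + 2 then (2 : F) • (w.conj * (x.off (i + 1)).conj) else 0 := rfl

theorem lower_diag (i j : Fin 3) (w : SplitOctonion F) (x : Albert F) :
    (lower i w x).diag j = x.diag j +
      if j = i + 2 then 4 * (normPolar w (x.off i) + x.diag (i + 1) * w.norm) else 0 := rfl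

theorem lower_off (i j : Fin 3) (w : SplitOctonion F) (x : Albert F) :
    (lower i w x).off j = x.off j +
      if j = i then x.diag (i + 1) • w
      else if j = i + 1 then (2 : F) • ((x.off (i + 2)).conj * w.conj) else 0 := rfl

theorem fin_three_eq_or (i j : Fin 3) : i = j ∨ j = i + 1 ∨ j = i + 2 := by decide +revert

theorem fin_three_ne_add (i : Fin 3) : (i ≠ i + 1 ∧ i ≠ i + 2 ∧ i + 1 ≠ i + 2) ∧
    i + 1 ≠ i ∧ i + 2 ≠ i ∧ i + 2 ≠ i + 1 := by decide +revert

/-- A sum over three indices, starting from an arbitrary one in cyclic order. -/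
theorem sum_fin_three (i : Fin 3) (f : Fin 3 → F) : ∑ j, f j = f i + f (i + 1) + f (i + 2) := by
  rw [Fin.sum_univ_three]
  fin_cases i <;> simp <;> ring

/-- The norm computed with the indices in cyclic order from an arbitrary one. -/
theorem N_eq (i : Fin 3) (x : Albert F) : N x = x.diag i * x.diag (i + 1) * x.diag (i + 2)
    + 8 * normPolar (x.off i) ((x.off (i + 1)).conj * (x.off (i + 2)).conj)
    - 4 * (x.diag i * (x.off i).norm + x.diag (i + 1) * (x.off (i + 1)).norm
      + x.diag (i + 2) * (x.off (i + 2)).norm) := by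
  have h1 := normPolar_cyclic (x.off 0) (x.off 1) (x.off 2)
  have h3 := normPolar_cyclic (x.off 1) (x.off 2) (x.off 0)
  rw [N, Fin.sum_univ_three]
  fin_cases i <;> simp <;> grind

theorem upper_neg_upper (i : Fin 3) (w : SplitOctonion F) (x : Albert F) :
    upper i (-w) (upper i w x) = x := by
  ext1
  · ext j
    fin_cases i <;> fin_cases j <;>
      simp [upper_diag, upper_off, normPolar_add, normPolar_smul, neg_normPolar, norm_neg',
        normPolar_self] <;> ring
  · ext1 j
    fin_cases i <;> fin_cases j <;>
      simp [upper_diag, upper_off, conj_neg, neg_mul']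

theorem lower_neg_lower (i : Fin 3) (w : SplitOctonion F) (x : Albert F) :
    lower i (-w) (lower i w x) = x := by
  ext1
  · ext j
    fin_cases i <;> fin_cases j <;>
      simp [lower_diag, lower_off, normPolar_add, normPolar_smul, neg_normPolar, norm_neg',
        normPolar_self] <;> ring
  · ext1 j
    fin_cases i <;> fin_cases j <;>
      simp [lower_diag, lower_off, conj_neg, mul_neg']

/-- The transvection `upper i w` as a bijection, with inverse `upper i (-w)`. -/
def upperEquiv (i : Fin 3) (w : SplitOctonion F) : Albert F ≃ₗ[F] Albert F :=
  { upper i w with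
    invFun := upper i (-w)
    left_inv := upper_neg_upper i w
    right_inv := fun x => by simpa using upper_neg_upper i (-w) x }

/-- The transvection `lower i w` as a bijection, with inverse `lower i (-w)`. -/
def lowerEquiv (i : Fin 3) (w : SplitOctonion F) : Albert F ≃ₗ[F] Albert F :=
  { lower i w with
    invFun := lower i (-w)
    left_inv := lower_neg_lower i w
    right_inv := fun x => by simpa using lower_neg_lower i (-w) x }

theorem upperEquiv_apply (i : Fin 3) (w : SplitOctonion F) (x : Albert F) :
    upperEquiv i w x = upper i w x := rfl

theorem lowerEquiv_apply (i : Fin 3) (w : SplitOctonion F) (x : Albert F) :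
    lowerEquiv i w x = lower i w x := rfl

theorem N_upper (i : Fin 3) (w : SplitOctonion F) (x : Albert F) : N (upper i w x) = N x := by
  rw [N_eq i, N_eq i]
  simp only [upper_diag, upper_off, fin_three_ne_add, if_true, if_false, add_zero, conj_add,
    add_mul', mul_add', conj_smul, mul_smul', SplitOctonion.smul_mul', conj_conj,
    SplitOctonion.conj_mul, norm_add, norm_smul', norm_conj, norm_mul', normPolar_add,
    add_normPolar, normPolar_smul, smul_normPolar, conj_mul_cancel, mul_mul_conj_cancel,
    normPolar_self, normPolar_comm (_ * _), normPolar_comm (x.off i) w,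
    normPolar_cyclic (x.off (i + 2)) w]
  ring

theorem adj_upper (h2 : (2 : F) ≠ 0) (i : Fin 3) (w : SplitOctonion F) (x : Albert F) :
    adj (upper i w x) = lower i (-w) (adj x) := by
  ext1
  · ext j
    obtain rfl | rfl | rfl := fin_three_eq_or i j <;>
    simp only [lower_diag, upper_diag, upper_off, adj_diag h2, adj_off h2, fin_three_add_add,
      fin_three_ne_add, if_true, if_false, add_zero, norm_add, norm_smul', norm_mul', norm_conj,
      norm_neg', neg_normPolar, normPolar_smul, normPolar_sub, normPolar_comm (x.off i) w,
      normPolar_cyclic (x.off (i + 2)) w] <;>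
    ring
  · ext1 j
    obtain rfl | rfl | rfl := fin_three_eq_or i j <;>
    simp only [lower_off, upper_diag, upper_off, adj_diag h2, adj_off h2, fin_three_add_add,
      fin_three_ne_add, if_true, if_false, add_zero, conj_add, add_mul', mul_add', conj_sub,
      conj_neg, neg_mul', mul_neg', mul_sub', sub_mul', conj_smul, mul_smul',
      SplitOctonion.smul_mul', conj_conj, SplitOctonion.conj_mul, conj_mul_cancel,
      mul_mul_conj_cancel]
    -- The linearized alternative law is needed in only one of the three positions.
    all_goals
      have h := mul_mul_conj_cancel_add w (x.off i) (x.off (i + 1))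
      first
      | module
      | linear_combination (norm := module) (4 : F) • h

theorem N_lower (i : Fin 3) (w : SplitOctonion F) (x : Albert F) : N (lower i w x) = N x := by
  rw [N_eq i, N_eq i]
  simp only [lower_diag, lower_off, fin_three_ne_add, if_true, if_false, add_zero, conj_add,
    add_mul', mul_add', conj_smul, mul_smul', SplitOctonion.smul_mul', conj_conj,
    SplitOctonion.conj_mul, norm_add, norm_smul', norm_conj, norm_mul', normPolar_add,
    add_normPolar, normPolar_smul, smul_normPolar, conj_mul_cancel, mul_mul_conj_cancel,
    normPolar_self, normPolar_comm (_ * _), normPolar_comm (x.off i) w,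
    ← normPolar_cyclic w (x.off (i + 1))]
  ring

theorem adj_lower (h2 : (2 : F) ≠ 0) (i : Fin 3) (w : SplitOctonion F) (x : Albert F) :
    adj (lower i w x) = upper i (-w) (adj x) := by
  ext1
  · ext j
    obtain rfl | rfl | rfl := fin_three_eq_or i j <;>
    simp only [upper_diag, lower_diag, lower_off, adj_diag h2, adj_off h2, fin_three_add_add,
      fin_three_ne_add, if_true, if_false, add_zero, norm_add, norm_smul', norm_mul', norm_conj,
      norm_neg', neg_normPolar, normPolar_smul, normPolar_sub, normPolar_comm (x.off i) w,
      ← normPolar_cyclic w (x.off (i + 1))] <;>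
    ring
  · ext1 j
    obtain rfl | rfl | rfl := fin_three_eq_or i j <;>
    simp only [upper_off, lower_diag, lower_off, adj_diag h2, adj_off h2, fin_three_add_add,
      fin_three_ne_add, if_true, if_false, add_zero, conj_add, add_mul', mul_add', conj_sub,
      conj_neg, neg_mul', mul_neg', mul_sub', sub_mul', conj_smul, mul_smul',
      SplitOctonion.smul_mul', conj_conj, SplitOctonion.conj_mul, conj_mul_cancel,
      mul_mul_conj_cancel]
    -- The linearized alternative law is needed in only one of the three positions.
    all_goals
      have h := conj_mul_cancel_add w (x.off i) (x.off (i + 2))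
      first
      | module
      | linear_combination (norm := module) (4 : F) • h

theorem trace_upper_mul_lower (i : Fin 3) (w : SplitOctonion F) (x y : Albert F) :
    T (upper i w x * lower i (-w) y) = T (x * y) := by
  rw [trace_mul, trace_mul, sum_fin_three i, sum_fin_three i]
  simp only [upper_diag, upper_off, lower_diag, lower_off, fin_three_ne_add, if_true, if_false,
    add_zero, norm_neg', neg_normPolar, conj_neg, mul_neg', normPolar_add, add_normPolar,
    normPolar_smul, smul_normPolar, smul_neg, normPolar_neg, normPolar_comm (_ * _),
    normPolar_self, normPolar_cyclic (y.off (i + 2)) w, ← normPolar_cyclic w (x.off (i + 1))]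
  rw [normPolar_comm (x.off i) w]
  ring

theorem adjointPair_upper (h2 : (2 : F) ≠ 0) (i : Fin 3) (w : SplitOctonion F) :
    AdjointPair (upperEquiv i w) (lowerEquiv i (-w)) where
  isometry := N_upper i w
  isometry' := N_lower i (-w)
  adj_apply := adj_upper h2 i w
  adj_apply' x := by
    have h := adj_lower h2 i (-w) x
    rwa [neg_neg] at h
  trace_mul := trace_upper_mul_lower i w

theorem adjointPair_lower (h2 : (2 : F) ≠ 0) (i : Fin 3) (w : SplitOctonion F) :
    AdjointPair (lowerEquiv i w) (upperEquiv i (-w)) := by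
  simpa using (adjointPair_upper h2 i (-w)).symm

/-! ### Diagonal scalings -/

/-- The map `x ↦ g x g` with `g` the diagonal matrix with entries `c`, `c⁻¹` and `1` in positions
`i`, `i + 1` and `i + 2`. -/
def scale (i : Fin 3) (c : F) : Albert F →ₗ[F] Albert F where
  toFun x :=
    { diag := fun j => (if j = i then c ^ 2 else if j = i + 1 then c⁻¹ ^ 2 else 1) * x.diag j
      off := fun j => (if j = i then c⁻¹ else if j = i + 1 then c else 1) • x.off j }
  map_add' x y := by
    ext1
    · ext j; exact mul_add _ _ _
    · ext1 j; exact smul_add _ _ _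
  map_smul' c x := by
    ext1
    · ext j; exact mul_left_comm _ _ _
    · ext1 j; exact smul_comm (_ : F) c (x.off j)

theorem scale_diag (i j : Fin 3) (c : F) (x : Albert F) : (scale i c x).diag j =
    (if j = i then c ^ 2 else if j = i + 1 then c⁻¹ ^ 2 else 1) * x.diag j := rfl

theorem scale_off (i j : Fin 3) (c : F) (x : Albert F) : (scale i c x).off j =
    (if j = i then c⁻¹ else if j = i + 1 then c else 1) • x.off j := rfl

theorem scale_inv_scale (i : Fin 3) {c : F} (hc : c ≠ 0) (x : Albert F) :
    scale i c⁻¹ (scale i c x) = x := by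
  ext1
  · ext j
    simp only [scale_diag]
    split_ifs <;> field_simp
  · ext1 j
    simp only [scale_off, smul_smul]
    split_ifs <;> simp [hc]

/-- The map `scale i c` as a bijection, with inverse `scale i c⁻¹`. -/
def scaleEquiv (i : Fin 3) {c : F} (hc : c ≠ 0) : Albert F ≃ₗ[F] Albert F :=
  { scale i c with
    invFun := scale i c⁻¹
    left_inv := scale_inv_scale i hc
    right_inv := fun x => by simpa using scale_inv_scale i (inv_ne_zero hc) x }

theorem N_scale (i : Fin 3) {c : F} (hc : c ≠ 0) (x : Albert F) : N (scale i c x) = N x := by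
  simp only [N, scale_diag, scale_off, Fin.sum_univ_three, conj_smul, SplitOctonion.smul_mul',
    mul_smul', normPolar_smul, smul_normPolar, norm_smul']
  fin_cases i <;> simp <;> field_simp

theorem adj_scale (h2 : (2 : F) ≠ 0) (i : Fin 3) {c : F} (hc : c ≠ 0) (x : Albert F) :
    adj (scale i c x) = scale i c⁻¹ (adj x) := by
  ext1
  · ext j
    simp only [adj_diag h2, scale_diag, scale_off, norm_smul']
    fin_cases i <;> fin_cases j <;> simp <;> field_simp
  · ext1 j
    simp only [adj_off h2, scale_diag, scale_off, conj_smul, SplitOctonion.smul_mul', mul_smul']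
    fin_cases i <;> fin_cases j <;> simp <;> match_scalars <;> field_simp

theorem trace_scale_mul_scale (i : Fin 3) {c : F} (hc : c ≠ 0) (x y : Albert F) :
    T (scale i c x * scale i c⁻¹ y) = T (x * y) := by
  simp only [trace_mul, scale_diag, scale_off, normPolar_smul, smul_normPolar]
  refine Finset.sum_congr rfl fun j _ => ?_
  split_ifs <;> field_simp

theorem adjointPair_scale (h2 : (2 : F) ≠ 0) (i : Fin 3) {c : F} (hc : c ≠ 0) :
    AdjointPair (scaleEquiv i hc) (scaleEquiv i (inv_ne_zero hc)) where
  isometry := N_scale i hc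
  isometry' := N_scale i (inv_ne_zero hc)
  adj_apply := adj_scale h2 i hc
  adj_apply' x := by
    have h := adj_scale h2 i (inv_ne_zero hc) x
    rwa [inv_inv] at h
  trace_mul := trace_scale_mul_scale i hc

end Albert

/-! ### Diagonalization and the ranks of diagonal elements -/

namespace SplitOctonion
variable {F : Type*} [Field F]

/-- The polar form of the norm is nondegenerate; each `w` below picks out one coordinate of `a`. -/
theorem eq_zero_of_normPolar_eq_zero {a : SplitOctonion F} (h : ∀ w, normPolar w a = 0) :
    a = 0 := by
  have h00 := h ⟨!![0, 0; 0, 1], 0⟩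
  have h01 := h ⟨!![0, 0; 1, 0], 0⟩
  have h10 := h ⟨!![0, 1; 0, 0], 0⟩
  have h11 := h ⟨!![1, 0; 0, 0], 0⟩
  have k00 := h ⟨0, !![0, 0; 0, 1]⟩
  have k01 := h ⟨0, !![0, 0; 1, 0]⟩
  have k10 := h ⟨0, !![0, 1; 0, 0]⟩
  have k11 := h ⟨0, !![1, 0; 0, 0]⟩
  simp [normPolar_eq] at h00 h01 h10 h11 k00 k01 k10 k11
  exact ext_entries h00 h01 h10 h11 k00 k01 k10 k11

/-- The new diagonal entry produced by a transvection depends on its parameter `w` as on the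
left-hand side of `h`. It can be made nonzero unless the whole `2 × 2` block with entries `α`, `β`,
`a` vanishes. -/
theorem eq_zero_of_quadratic_eq_zero (h2 : (2 : F) ≠ 0) {α β : F} {a : SplitOctonion F}
    (h : ∀ w, α + 4 * (normPolar w a + β * w.norm) = 0) : α = 0 ∧ β = 0 ∧ a = 0 := by
  have h4 : (4 : F) ≠ 0 := by
    rw [show (4 : F) = 2 * 2 by norm_num]; exact mul_ne_zero h2 h2
  have hα : α = 0 := by simpa [normPolar, norm] using h 0
  subst hα
  have h' : ∀ w, normPolar w a + β * w.norm = 0 := fun w => by simpa [h4] using h w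
  have ha : a = 0 := eq_zero_of_normPolar_eq_zero fun w => by
    -- Comparing `w` with `-w` separates the linear part from the quadratic part.
    have h1 := h' w
    have h3 := h' (-w)
    rw [neg_normPolar, norm_neg'] at h3
    exact (mul_eq_zero.1 (show 2 * normPolar w a = 0 by linear_combination h1 - h3)).resolve_left h2
  refine ⟨rfl, ?_, ha⟩
  subst ha
  simpa [normPolar_eq, norm] using h' 1

end SplitOctonion

namespace Albert
open SplitOctonion
variable {F : Type*} [Field F]

theorem upper_E {i k : Fin 3} (hk : k ≠ i + 2) (w : SplitOctonion F) : upper i w (E k) = E k := by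
  have h0 : (E k : Albert F).diag (i + 2) = 0 := Pi.single_eq_of_ne hk.symm 1
  have h1 : (E k : Albert F).off = 0 := rfl
  ext1
  · ext j
    simp [upper_diag, h0, h1]
  · ext1 j
    simp [upper_off, h0, h1]

theorem lower_E {i k : Fin 3} (hk : k ≠ i + 1) (w : SplitOctonion F) : lower i w (E k) = E k := by
  have h0 : (E k : Albert F).diag (i + 1) = 0 := Pi.single_eq_of_ne hk.symm 1
  have h1 : (E k : Albert F).off = 0 := rfl
  ext1
  · ext j
    simp [lower_diag, h0, h1]
  · ext1 j
    simp [lower_off, h0, h1]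

theorem scale_E {i k : Fin 3} (hk : k ≠ i) (hk' : k ≠ i + 1) (c : F) : scale i c (E k) = E k := by
  ext1
  · ext j
    rw [scale_diag]
    obtain rfl | hj := eq_or_ne j k
    · simp [hk, hk']
    · simp [E, hj]
  · ext1 j
    simp [scale_off, E]

theorem scale_smul_E (i : Fin 3) (c d : F) : scale i c (d • E i) = (c ^ 2 * d) • E i := by
  rw [map_smul]
  ext1
  · ext j
    simp only [diag_smul, Pi.smul_apply, scale_diag, smul_eq_mul]
    obtain rfl | hj := eq_or_ne j i
    · simp; ring
    · simp [E, hj]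
  · ext1 j
    simp [scale_off, E]

/-- A nonzero diagonal entry can be used to clear the other entries of its row and column. -/
theorem exists_clear (h2 : (2 : F) ≠ 0) (i : Fin 3) (x : Albert F) (hx : x.diag (i + 2) ≠ 0) :
    ∃ φ ψ, AdjointPair φ ψ ∧ (∀ k, k ≠ i + 2 → φ (E k) = E k) ∧
      (φ x).diag (i + 2) = x.diag (i + 2) ∧ (φ x).off i = 0 ∧ (φ x).off (i + 1) = 0 := by
  refine ⟨_, _, (adjointPair_upper h2 i (-((x.diag (i + 2))⁻¹ • x.off i))).trans
    (adjointPair_lower h2 (i + 1) (-((x.diag (i + 2))⁻¹ • x.off (i + 1)))), fun k hk => ?_, ?_, ?_,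
        ?_⟩
  · simp only [LinearEquiv.trans_apply, upperEquiv_apply, lowerEquiv_apply, upper_E hk]
    exact lower_E (by simpa only [fin_three_add_add] using hk) _
  all_goals
    simp [LinearEquiv.trans_apply, upperEquiv_apply, lowerEquiv_apply, lower_diag, lower_off,
      upper_diag, upper_off, fin_three_add_add, fin_three_ne_add, smul_smul, hx]

/-- Every nonzero element can be moved to one whose first diagonal entry is nonzero. -/
theorem exists_diag_zero_ne (h2 : (2 : F) ≠ 0) {x : Albert F} (hx : x ≠ 0) :
    ∃ φ ψ, AdjointPair φ ψ ∧ (φ x).diag 0 ≠ 0 := by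
  by_contra! H
  -- Since `x` may be replaced by any `φ x`, each transvection into the first row shows that a
  -- whole block vanishes.
  have key : ∀ φ ψ, AdjointPair φ ψ → (φ x).diag 1 = 0 ∧ (φ x).off 2 = 0 := by
    intro φ ψ h
    exact (eq_zero_of_quadratic_eq_zero h2 fun w =>
      H _ _ (h.trans (adjointPair_upper h2 2 w))).2
  have h1 := eq_zero_of_quadratic_eq_zero h2 fun w => H _ _ (adjointPair_lower h2 1 w)
  have h3 := eq_zero_of_quadratic_eq_zero h2 fun w => (key _ _ (adjointPair_upper h2 0 w)).1
  have h4 := key _ _ AdjointPair.refl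
  apply hx
  ext1
  · ext j
    fin_cases j
    exacts [h1.1, h3.1, h3.2.1]
  · ext1 j
    fin_cases j
    exacts [h3.2.2, h1.2.2, h4.2]

/-- Every element can be diagonalized. -/
theorem exists_off_eq_zero (h2 : (2 : F) ≠ 0) (x : Albert F) :
    ∃ φ ψ, AdjointPair φ ψ ∧ (φ x).off = 0 := by
  by_cases hx : x = 0
  · exact ⟨_, _, AdjointPair.refl, by rw [hx]; rfl⟩
  obtain ⟨φ, ψ, h, h0⟩ := exists_diag_zero_ne h2 hx
  obtain ⟨φ', ψ', h', -, -, h1, h3⟩ := exists_clear h2 1 (φ x) h0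
  replace h1 : (φ' (φ x)).off 1 = 0 := h1
  replace h3 : (φ' (φ x)).off 2 = 0 := h3
  generalize hz : φ' (φ x) = z at h1 h3
  suffices H : ∃ φ ψ, AdjointPair φ ψ ∧ (φ z).off = 0 by
    obtain ⟨φ'', ψ'', h'', H⟩ := H
    exact ⟨_, _, (h.trans h').trans h'', by rw [← hz] at H; exact H⟩
  -- The first row is cleared; the remaining block has entries `z.diag 1`, `z.diag 2`, `z.off 0`.
  -- Either it vanishes, or `z.diag 1` can be made nonzero and used to clear `z.off 0`.
  by_cases hw : ∀ w, (upper 0 w z).diag 1 = 0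
  · refine ⟨_, _, AdjointPair.refl, ?_⟩
    ext1 j
    fin_cases j
    exacts [(eq_zero_of_quadratic_eq_zero h2 hw).2.2, h1, h3]
  push Not at hw
  obtain ⟨w, hw⟩ := hw
  have e1 : (upper 0 w z).off 1 = 0 := by simp [upper_off, h1]
  have e2 : (upper 0 w z).off 2 = 0 := by
    simp [upper_off, h1, h3]
  refine ⟨_, _, (adjointPair_upper h2 0 w).trans
    (adjointPair_lower h2 0 (-(((upper 0 w z).diag 1)⁻¹ • (upper 0 w z).off 0))), ?_⟩
  ext1 j
  simp only [LinearEquiv.trans_apply, upperEquiv_apply, lowerEquiv_apply]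
  rw [lower_off]
  fin_cases j
  · simp [smul_smul, hw]
  · simp [e1, e2]
  · simp [e2]

/-- The `27` coordinates of an element: the diagonal entries, and the entries of the two matrices
that make up each off-diagonal octonion. -/
def coordinates : Albert F ≃ₗ[F] (Fin 3 ⊕ Fin 3 × Fin 2 × Fin 2 × Fin 2 → F) where
  toFun x := Sum.elim x.diag fun p => ![(x.off p.1).fst, (x.off p.1).snd] p.2.1 p.2.2.1 p.2.2.2
  invFun f :=
    { diag := fun i => f (Sum.inl i)
      off := fun i => ⟨fun j k => f (Sum.inr (i, 0, j, k)), fun j k => f (Sum.inr (i, 1, j, k))⟩ }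
  left_inv _ := rfl
  right_inv f := by
    ext (i | ⟨i, s, j, k⟩)
    · rfl
    · fin_cases s <;> rfl
  map_add' x y := by
    ext (i | ⟨i, s, j, k⟩)
    · rfl
    · fin_cases s <;> rfl
  map_smul' c x := by
    ext (i | ⟨i, s, j, k⟩)
    · rfl
    · fin_cases s <;> rfl

theorem U_diag_of_off_eq_zero {x : Albert F} (hx : x.off = 0) (y : Albert F) (i : Fin 3) :
    (U x y).diag i = x.diag i ^ 2 * y.diag i := by
  rw [U_apply]
  simp [diag_mul, hx, off_mul]
  ring

theorem U_off_of_off_eq_zero (h2 : (2 : F) ≠ 0) {x : Albert F} (hx : x.off = 0)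
    (y : Albert F) (i : Fin 3) :
    (U x y).off i = (x.diag (i + 1) * x.diag (i + 2)) • y.off i := by
  rw [U_apply]
  simp only [off_sub, off_smul, Pi.sub_apply, Pi.smul_apply, off_mul, diag_mul, hx, Pi.zero_apply,
    smul_zero, conj_zero, zero_mul', mul_zero', add_zero, normPolar_zero, mul_zero]
  match_scalars
  field_simp
  ring

theorem rank_of_off_eq_zero (h2 : (2 : F) ≠ 0) {x : Albert F} (hx : x.off = 0) [DecidableEq F] :
    rank x = (∑ i, if x.diag i ≠ 0 then 1 else 0) +
      8 * ∑ i, if x.diag (i + 1) * x.diag (i + 2) ≠ 0 then 1 else 0 := by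
  let w : Fin 3 ⊕ Fin 3 × Fin 2 × Fin 2 × Fin 2 → F :=
    Sum.elim (fun i => x.diag i ^ 2) fun p => x.diag (p.1 + 1) * x.diag (p.1 + 2)
  have hU : (coordinates : Albert F ≃ₗ[F] _).toLinearMap ∘ₗ U x =
      (Matrix.diagonal w).mulVecLin ∘ₗ (coordinates : Albert F ≃ₗ[F] _).toLinearMap := by
    refine LinearMap.ext fun y => ?_
    ext (i | ⟨i, s, j, k⟩)
    · simpa [coordinates, w, Matrix.mulVec_diagonal] using U_diag_of_off_eq_zero hx y i
    · have h := U_off_of_off_eq_zero h2 hx y i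
      fin_cases s <;> simp [coordinates, w, Matrix.mulVec_diagonal, h]
  have h1 : rank x = (Matrix.diagonal w).rank := by
    rw [rank, Matrix.rank, ← LinearEquiv.finrank_map_eq coordinates, ← LinearMap.range_comp, hU,
      LinearMap.range_comp, LinearEquiv.range, Submodule.map_top]
  rw [h1, Matrix.rank_diagonal, Fintype.card_subtype, Finset.card_filter]
  simp only [Fintype.sum_sum_type, Fintype.sum_prod_type, w, Sum.elim_inl, Sum.elim_inr]
  simp only [Finset.sum_const, Finset.card_univ, Fintype.card_fin, smul_eq_mul, Finset.mul_sum,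
    ne_eq, sq_eq_zero_iff]
  norm_num

/-- The possible ranks, and how the adjoint and the norm distinguish them. -/
theorem rank_cases (h2 : (2 : F) ≠ 0) (x : Albert F) :
    (x = 0 ∧ rank x = 0) ∨ (x ≠ 0 ∧ adj x = 0 ∧ N x = 0 ∧ rank x = 1) ∨
    (adj x ≠ 0 ∧ adj (adj x) = 0 ∧ N x = 0 ∧ rank x = 10) ∨
    (adj x ≠ 0 ∧ N x ≠ 0 ∧ N (adj x) ≠ 0 ∧ rank x = 27) := by
  classical
  obtain ⟨φ, ψ, h, hx⟩ := exists_off_eq_zero h2 x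
  have e1 : φ x = 0 ↔ x = 0 := φ.map_eq_zero_iff
  have e2 : adj (φ x) = 0 ↔ adj x = 0 := by rw [h.adj_apply]; exact ψ.map_eq_zero_iff
  have e3 : adj (adj (φ x)) = 0 ↔ adj (adj x) = 0 := by
    rw [h.adj_apply, h.adj_apply']; exact φ.map_eq_zero_iff
  have e4 : N (adj (φ x)) = N (adj x) := by rw [h.adj_apply]; exact h.isometry' _
  rw [ne_eq, ne_eq, ← e1, ← e2, ← e3, ← e4, ← h.isometry x, ← h.rank_apply h2 x]
  generalize φ x = y at hx
  obtain ⟨d, a⟩ := y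
  obtain rfl : a = 0 := hx
  have ha : ∀ d : Fin 3 → F, adj ⟨d, 0⟩ = ⟨fun i => d (i + 1) * d (i + 2), 0⟩ := fun d => by
    ext1
    · ext i
      simp [adj_diag h2]
    · ext1 i
      simp [adj_off h2]
  have hN : ∀ e : Fin 3 → F, N ⟨e, 0⟩ = e 0 * e 1 * e 2 := fun e => by
    simp [N]
  have h0 : ∀ e : Fin 3 → F, (⟨e, 0⟩ : Albert F) = 0 ↔ e 0 = 0 ∧ e 1 = 0 ∧ e 2 = 0 := fun e => by
    simp [Albert.ext_iff, funext_iff, Fin.forall_fin_succ]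
  rw [rank_of_off_eq_zero h2 rfl, ha, ha, hN, hN, h0, h0, h0]
  simp only [Fin.sum_univ_three, Fin.isValue, Fin.reduceAdd, zero_add]
  by_cases h0 : d 0 = 0 <;> by_cases h1 : d 1 = 0 <;> by_cases h3 : d 2 = 0 <;> simp [h0, h1, h3]

/-! ### Rank one elements and the diagonal idempotents -/

theorem adj_eq_zero_of_rank_eq_one (h2 : (2 : F) ≠ 0) {x : Albert F} (hx : rank x = 1) :
    x ≠ 0 ∧ adj x = 0 ∧ N x = 0 := by
  have := rank_cases h2 x
  grind

/-- The norm vanishes on the sum of two elements of rank at most one. -/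
theorem N_add_eq_zero (h2 : (2 : F) ≠ 0) {x y : Albert F} (hx : adj x = 0) (hx' : N x = 0)
    (hy : adj y = 0) (hy' : N y = 0) : N (x + y) = 0 := by
  rw [N_add h2, hx, hx', hy, hy', trace_mul, trace_mul]
  simp

/-- An element with zero adjoint has rank at most one, so clearing a row and column leaves only the
pivot. -/
theorem exists_map_eq_smul_E (h2 : (2 : F) ≠ 0) (k : Fin 3) {x : Albert F} (hx : adj x = 0)
    (hk : x.diag k ≠ 0) :
    ∃ φ ψ, AdjointPair φ ψ ∧ (∀ j, j ≠ k → φ (E j) = E j) ∧ φ x = x.diag k • E k := by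
  obtain ⟨i, rfl⟩ : ∃ i, k = i + 2 := ⟨k + 1, by simp [fin_three_add_add]⟩
  obtain ⟨φ, ψ, h, hE, hd, h0, h1⟩ := exists_clear h2 i x hk
  refine ⟨φ, ψ, h, hE, ?_⟩
  have ha : adj (φ x) = 0 := by rw [h.adj_apply, hx, map_zero]
  rw [← hd] at hk ⊢
  generalize φ x = y at *
  have a0 := adj_diag h2 y i
  have a1 := adj_diag h2 y (i + 1)
  have a3 := adj_off h2 y (i + 2)
  simp only [ha, fin_three_add_add, h0, h1, diag_zero, off_zero, Pi.zero_apply, norm_zero',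
    mul_zero, sub_zero, conj_zero, SplitOctonion.zero_mul', smul_zero, zero_sub] at a0 a1 a3
  have b0 : y.diag (i + 1) = 0 := (mul_eq_zero.1 a0.symm).resolve_right hk
  have b1 : y.diag i = 0 := (mul_eq_zero.1 a1.symm).resolve_left hk
  have b3 : y.off (i + 2) = 0 := (smul_eq_zero.1 (neg_eq_zero.1 a3.symm)).resolve_left hk
  ext1
  · ext j
    obtain rfl | rfl | rfl := fin_three_eq_or i j <;> simp [E, b0, b1, fin_three_ne_add]
  · ext1 j
    obtain rfl | rfl | rfl := fin_three_eq_or i j <;> simp [E, h0, h1, b3]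

theorem exists_map_eq_E [IsAlgClosed F] (h2 : (2 : F) ≠ 0) (k : Fin 3) {x : Albert F}
    (hx : adj x = 0) (hk : x.diag k ≠ 0) :
    ∃ φ ψ, AdjointPair φ ψ ∧ (∀ j, j ≠ k → j ≠ k + 1 → φ (E j) = E j) ∧ φ x = E k := by
  obtain ⟨φ, ψ, h, hE, h'⟩ := exists_map_eq_smul_E h2 k hx hk
  -- The scaling multiplies the pivot by `c ^ 2`.
  obtain ⟨c, hc⟩ := IsAlgClosed.exists_pow_nat_eq (x.diag k)⁻¹ two_pos
  have hc0 : c ≠ 0 := by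
    rintro rfl
    exact inv_ne_zero hk (by rw [← hc]; simp)
  refine ⟨_, _, h.trans (adjointPair_scale h2 k hc0), fun j hj hj' => ?_, ?_⟩
  · rw [LinearEquiv.trans_apply, hE j hj]
    exact scale_E hj hj' c
  · rw [LinearEquiv.trans_apply, h']
    refine (scale_smul_E k c _).trans ?_
    rw [hc, inv_mul_cancel₀ hk, one_smul]

theorem adj_E (h2 : (2 : F) ≠ 0) (k : Fin 3) : adj (E k : Albert F) = 0 := by
  ext1
  · ext i
    fin_cases k <;> fin_cases i <;> simp [adj_diag h2, E]
  · ext1 i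
    simp [adj_off h2, E]

theorem N_E (k : Fin 3) : N (E k : Albert F) = 0 := by
  fin_cases k <;> simp [N, E]

/-- For `y` with zero adjoint, `adj (E 0 + y)` is the linearized adjoint of `E 0` and `y`; it records
the block of `y` opposite to `E 0`. -/
theorem adj_E_zero_add (h2 : (2 : F) ≠ 0) {y : Albert F} (hy : adj y = 0) :
    adj (E 0 + y) = ⟨![0, y.diag 2, y.diag 1], Pi.single 0 (-y.off 0)⟩ := by
  have h : adj (E 0 + y) = cross (E 0) y := by rw [cross, adj_E h2, hy, sub_zero, sub_zero]
  rw [h]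
  ext1
  · ext i
    fin_cases i <;> simp [cross_diag h2, E]
  · ext1 i
    fin_cases i <;> simp [cross_off h2, E]

/-- If `E 0 + y` is not of rank at most one, then the block of `y` opposite to `E 0` does not
vanish, and a transvection fixing `E 0` makes its first diagonal entry nonzero. -/
theorem exists_map_E_zero_and_diag_one_ne (h2 : (2 : F) ≠ 0) {y : Albert F} (hy : adj y = 0)
    (h : adj (E 0 + y) ≠ 0) : ∃ φ ψ, AdjointPair φ ψ ∧ φ (E 0) = E 0 ∧ (φ y).diag 1 ≠ 0 := by
  by_contra! H
  obtain ⟨h1, h3, h0⟩ := eq_zero_of_quadratic_eq_zero h2 fun w =>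
    H _ _ (adjointPair_upper h2 0 w) (upper_E (by decide) w)
  apply h
  rw [adj_E_zero_add h2 hy, h0, show y.diag 2 = 0 from h3, h1]
  ext1
  · ext i; fin_cases i <;> rfl
  · simp

theorem diag_two_eq_one (h2 : (2 : F) ≠ 0) {z : Albert F} (hz : adj z = 0) (hz' : N z = 0)
    (h : N (E 0 + E 1 + z) = 1) : z.diag 2 = 1 := by
  rw [N_add h2, adj_E_zero_add h2 (adj_E h2 1), hz, hz',
    N_add_eq_zero h2 (adj_E h2 0) (N_E 0) (adj_E h2 1) (N_E 1), trace_mul, trace_mul,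
    Fin.sum_univ_three] at h
  simpa [E] using h

/-- Rank one triples whose sum has norm one are isometric to `E 0, E 1, E 2`. -/
theorem exists_isometry_map_eq_E [IsAlgClosed F] (h2 : (2 : F) ≠ 0) (x : Fin 3 → Albert F)
    (hx : ∀ i, rank (x i) = 1) (hN : N (x 0 + x 1 + x 2) = 1) :
    ∃ f : Albert F ≃ₗ[F] Albert F, IsIsometry f ∧ ∀ i, f (x i) = E i := by
  have H := fun i => adj_eq_zero_of_rank_eq_one h2 (hx i)
  have map_adj : ∀ {φ ψ : Albert F ≃ₗ[F] Albert F}, AdjointPair φ ψ → ∀ i, adj (φ (x i)) = 0 :=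
    fun h i => by rw [h.adj_apply, (H i).2.1, map_zero]
  have map_N : ∀ {φ ψ : Albert F ≃ₗ[F] Albert F}, AdjointPair φ ψ → ∀ i, N (φ (x i)) = 0 :=
    fun h i => (h.isometry _).trans (H i).2.2
  have map_sum : ∀ {φ ψ : Albert F ≃ₗ[F] Albert F}, AdjointPair φ ψ →
      N (φ (x 0) + φ (x 1) + φ (x 2)) = 1 := fun h => by
    rw [← map_add, ← map_add, h.isometry, hN]
  obtain ⟨φ, ψ, h, h0⟩ : ∃ φ ψ, AdjointPair φ ψ ∧ φ (x 0) = E 0 := by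
    obtain ⟨φ, ψ, h, h0⟩ := exists_diag_zero_ne h2 (H 0).1
    obtain ⟨φ', ψ', h', -, h0'⟩ := exists_map_eq_E h2 0 (map_adj h 0) h0
    exact ⟨_, _, h.trans h', h0'⟩
  obtain ⟨φ, ψ, h, h0, h1⟩ : ∃ φ ψ, AdjointPair φ ψ ∧ φ (x 0) = E 0 ∧ φ (x 1) = E 1 := by
    -- Otherwise `E 0 + φ (x 1)` has rank at most one and the norm of the total sum is zero.
    have hne : adj (E 0 + φ (x 1)) ≠ 0 := fun h' => by
      have hs := map_sum h
      rw [h0, N_add_eq_zero h2 h' (N_add_eq_zero h2 (adj_E h2 0) (N_E 0) (map_adj h 1)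
        (map_N h 1)) (map_adj h 2) (map_N h 2)] at hs
      exact zero_ne_one hs
    obtain ⟨φ', ψ', h', h0', h1'⟩ := exists_map_E_zero_and_diag_one_ne h2 (map_adj h 1) hne
    obtain ⟨φ'', ψ'', h'', hE, h1''⟩ := exists_map_eq_E h2 1 (map_adj (h.trans h') 1) h1'
    refine ⟨_, _, (h.trans h').trans h'', ?_, h1''⟩
    simp only [LinearEquiv.trans_apply, h0, h0']
    exact hE 0 (by decide) (by decide)
  have hd : (φ (x 2)).diag 2 = 1 := by
    have hs := map_sum h
    rw [h0, h1] at hs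
    exact diag_two_eq_one h2 (map_adj h 2) (map_N h 2) hs
  obtain ⟨φ', ψ', h', hE, h2'⟩ :=
    exists_map_eq_smul_E h2 2 (map_adj h 2) (by rw [hd]; exact one_ne_zero)
  refine ⟨_, (h.trans h').isometry, fun i => ?_⟩
  rw [LinearEquiv.trans_apply]
  fin_cases i
  · exact (congrArg φ' h0).trans (hE 0 (by decide))
  · exact (congrArg φ' h1).trans (hE 1 (by decide))
  · rw [hd, one_smul] at h2'
    exact h2'

end Albert

theorem mainTheorem5 {F : Type*} [Field F] [IsAlgClosed F] (h2 : (2 : F) ≠ 0) :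
    (∀ x y : Albert F, x.rank = 1 → y.rank = 1 → (x + y).N = 0) ∧
    (∀ x : Fin 3 → Albert F, (∀ i, (x i).rank = 1) → (x 0 + x 1 + x 2).N ≠ 0 →
      ∀ i j, i ≠ j → (x i + x j).rank = 10) ∧
    (∀ x : Fin 3 → Albert F, (∀ i, (x i).rank = 1) → (x 0 + x 1 + x 2).N = 1 →
      ∃ f : Albert F ≃ₗ[F] Albert F, Albert.IsIsometry f ∧ ∀ i, f (x i) = Albert.E i) ∧
    (∀ x : Albert F,
      (x.rank = 1 → x.adj.rank = 0) ∧
      (x.rank = 10 → x.adj.rank = 1) ∧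
      (x.rank = 27 → x.adj.rank = 27) ∧
      x.adj.rank ≤ x.rank) := by
  refine ⟨fun x y hx hy => ?_, fun x hx hN i j hij => ?_, Albert.exists_isometry_map_eq_E h2,
    fun x => ?_⟩
  · obtain ⟨-, hx, hx'⟩ := Albert.adj_eq_zero_of_rank_eq_one h2 hx
    obtain ⟨-, hy, hy'⟩ := Albert.adj_eq_zero_of_rank_eq_one h2 hy
    exact Albert.N_add_eq_zero h2 hx hx' hy hy'
  · have H := fun i => Albert.adj_eq_zero_of_rank_eq_one h2 (hx i)
    have h1 : ∀ i j, (x i + x j).N = 0 := fun i j =>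
      Albert.N_add_eq_zero h2 (H i).2.1 (H i).2.2 (H j).2.1 (H j).2.2
    -- If the adjoint were zero, adding the third rank one element would give norm zero.
    have h3 : (x i + x j).adj ≠ 0 := by
      intro h
      have h3 : ∀ k, (x i + x j + x k).N = 0 := fun k =>
        Albert.N_add_eq_zero h2 h (h1 i j) (H k).2.1 (H k).2.2
      apply hN
      obtain ⟨k, hk⟩ : ∃ k, x 0 + x 1 + x 2 = x i + x j + x k := by
        fin_cases i <;> fin_cases j <;> first | exact absurd rfl hij | skip
        exacts [⟨2, by simp⟩, ⟨1, by simp; abel⟩, ⟨2, by simp; abel⟩, ⟨0, by simp; abel⟩,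
          ⟨1, by simp; abel⟩, ⟨0, by simp; abel⟩]
      rw [hk, h3]
    have := Albert.rank_cases h2 (x i + x j)
    have h4 := h1 i j
    have h5 : x i + x j = 0 → (x i + x j).adj = 0 := fun h => by rw [h, Albert.adj_zero]
    grind
  · have h0 := Albert.adj_zero (F := F)
    have hx := Albert.rank_cases h2 x
    have hx' := Albert.rank_cases h2 x.adj
    grind
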